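/- Let $(\mathbb{R}^2,\|\cdot\|)$ be a normed plane (a two-dimensional real normed space). For a compact set $K$ let $\lambda_K$ be its minimal enclosing radius, i.e. the smallest $\lambda\ge 0$ such that $K$ is contained in a closed ball $B(c,\lambda)$ of radius $\lambda$ with some center $c$. Let $K$ be a compact convex set that is non-centrable, i.e. $\operatorname{diam}K\neq 2\lambda_K$ (equivalently, $\operatorname{diam}K<2\lambda_K$), and let $B(x,\lambda_K)$ be any minimal enclosing ball of $K$, i.e. $K\subseteq B(x,\lambda_K)$. Then there exist $m\in\{2,3\}$ and points $t_1,\dots,t_m\in \operatorname{bd}K\cap\operatorname{bd}B(x,\lambda_K)$ that are the vertices of an $(m-1)$-simplex (i.e. are affinely independent) such that $$x\in\operatorname{relint}\bigl(\operatorname{conv}\{t_1,\dots,t_m\}\bigr).$$ -/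

import Mathlib

namespace Chebyshev

/-- The minimal enclosing radius `λ_K` of a bounded set `K`: the smallest radius `r ≥ 0`
for which some closed ball of radius `r` contains `K`. -/
noncomputable def circumradius {E : Type*} [NormedAddCommGroup E] (K : Set E) : ℝ :=
  sInf {r : ℝ | 0 ≤ r ∧ ∃ c : E, K ⊆ Metric.closedBall c r}

/-- `B(x, λ_K)` is a minimal enclosing ball of `K`, i.e. `x` is a Chebyshev center of `K`. -/
def IsMinimalEnclosingCenter {E : Type*} [NormedAddCommGroup E] (K : Set E) (x : E) : Prop :=
  K ⊆ Metric.closedBall x (circumradius K)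

/-- A set is centrable if its diameter is twice its minimal enclosing radius. -/
def IsCentrable {E : Type*} [NormedAddCommGroup E] (K : Set E) : Prop :=
  Metric.diam K = 2 * circumradius K

/-- The critical set of `K` with respect to `x`: the boundary points of `K` that lie on the
boundary of the minimal enclosing ball `B(x, λ_K)`. -/
def criticalSet {E : Type*} [NormedAddCommGroup E] (K : Set E) (x : E) : Set E :=
  frontier K ∩ frontier (Metric.closedBall x (circumradius K))

end Chebyshev

open Set Metric Topology

namespace Chebyshev

variable {E : Type*} [NormedAddCommGroup E]

/-! Write `r` for the minimal radius. The core is `mem_convexHull_contact`: `x` lies in the convex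
hull of the contact points. Otherwise some functional `g` is positive on every `t - x`. Take a unit
`u` in `ker g` and a norming functional `l` of `u`. Unless contacts reach both levels `-r` and `r`
of `l`, the centre can be moved so as to shrink the ball; if they do, `diam K ≥ 2r`, against
non-centrability. Carathéodory then leaves at most three points with positive weights: one is
excluded by `r > 0`, and two would be antipodal. So in fact `m = 3`. -/

theorem circumradius_nonneg (K : Set E) : 0 ≤ circumradius K :=
  Real.sInf_nonneg fun _ h => h.1

theorem circumradius_le {K : Set E} {r : ℝ} {c : E} (hr : 0 ≤ r) (h : K ⊆ closedBall c r) :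
    circumradius K ≤ r :=
  csInf_le ⟨0, fun _ h => h.1⟩ ⟨hr, c, h⟩

theorem diam_lt_of_not_isCentrable {K : Set E} {x : E} (hK : ¬ IsCentrable K)
    (hx : IsMinimalEnclosingCenter K x) : diam K < 2 * circumradius K :=
  lt_of_le_of_ne ((diam_mono hx isBounded_closedBall).trans
    (diam_closedBall (circumradius_nonneg K))) hK

theorem circumradius_pos_of_not_isCentrable {K : Set E} {x : E} (hK : ¬ IsCentrable K)
    (hx : IsMinimalEnclosingCenter K x) : 0 < circumradius K := by
  have := diam_lt_of_not_isCentrable hK hx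
  have := diam_nonneg (s := K)
  linarith

variable [NormedSpace ℝ E]

/-- By convexity of the norm, a step that works can be shortened; this lets finitely many steps be
merged into one. -/
theorem norm_sub_smul_lt {t w : E} {r s s' : ℝ} (ht : ‖t‖ ≤ r) (h : ‖t - s • w‖ < r)
    (hs' : 0 < s') (hle : s' ≤ s) : ‖t - s' • w‖ < r := by
  have hs : 0 < s := hs'.trans_le hle
  have hc : 0 < s' / s := div_pos hs' hs
  have hc1 : s' / s ≤ 1 := (div_le_one hs).2 hle
  have e : t - s' • w = (1 - s' / s) • t + (s' / s) • (t - s • w) := by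
    rw [smul_sub, smul_smul, div_mul_cancel₀ _ hs.ne', sub_smul, one_smul]
    abel
  rw [e]
  refine (norm_add_le _ _).trans_lt ?_
  rw [norm_smul, norm_smul, Real.norm_of_nonneg hc.le, Real.norm_of_nonneg (by linarith)]
  nlinarith [mul_lt_mul_of_pos_left h hc]

/-- No direction strictly shrinks the distance from a Chebyshev center to every contact point. -/
theorem exists_contact_not_shrinking {K : Set E} {x : E} (hcomp : IsCompact K)
    (hpos : 0 < circumradius K) (hx : IsMinimalEnclosingCenter K x) (w : E) :
    ∃ t ∈ K, ‖t - x‖ = circumradius K ∧ ∀ s : ℝ, 0 < s → circumradius K ≤ ‖t - x - s • w‖ := by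
  by_contra! hcon
  set r := circumradius K with hr
  have hle : ∀ t ∈ K, ‖t - x‖ ≤ r := fun t ht => by
    simpa [dist_eq_norm] using hx ht
  have hex : ∀ t ∈ K, ∃ s : ℝ, 0 < s ∧ ‖t - x - s • w‖ < r := by
    intro t ht
    rcases (hle t ht).eq_or_lt with h | h
    · exact hcon t ht h
    · have hcont : Continuous fun s : ℝ => ‖t - x - s • w‖ := by fun_prop
      have h0 : ∀ᶠ s in 𝓝 (0 : ℝ), ‖t - x - s • w‖ < r :=
        hcont.continuousAt.eventually_lt continuousAt_const (by simpa using h)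
      obtain ⟨s, hs, hs0⟩ := ((h0.filter_mono nhdsWithin_le_nhds).and
        (self_mem_nhdsWithin : Ioi (0 : ℝ) ∈ 𝓝[>] 0)).exists
      exact ⟨s, hs0, hs⟩
  obtain ⟨s, hs, hsK⟩ : ∃ s : ℝ, 0 < s ∧ ∀ t ∈ K, t ∈ K → ‖t - x - s • w‖ < r := by
    refine hcomp.induction_on (p := fun S => ∃ s : ℝ, 0 < s ∧ ∀ t ∈ S, t ∈ K →
      ‖t - x - s • w‖ < r) ⟨1, one_pos, by simp⟩ ?_ ?_ ?_
    · rintro S S' hSS ⟨s, hs, h⟩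
      exact ⟨s, hs, fun t ht => h t (hSS ht)⟩
    · rintro S S' ⟨s, hs, h⟩ ⟨s', hs', h'⟩
      refine ⟨min s s', lt_min hs hs', ?_⟩
      rintro t (ht | ht) htK
      · exact norm_sub_smul_lt (hle t htK) (h t ht htK) (lt_min hs hs') (min_le_left _ _)
      · exact norm_sub_smul_lt (hle t htK) (h' t ht htK) (lt_min hs hs') (min_le_right _ _)
    · intro t ht
      obtain ⟨s, hs, h⟩ := hex t ht
      have hcont : Continuous fun y : E => ‖y - x - s • w‖ := by fun_prop
      exact ⟨{y | ‖y - x - s • w‖ < r},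
        mem_nhdsWithin_of_mem_nhds ((isOpen_lt hcont continuous_const).mem_nhds h),
        s, hs, fun y hy _ => hy⟩
  have hne : K.Nonempty := by
    rw [nonempty_iff_ne_empty]
    rintro rfl
    have : circumradius (∅ : Set E) ≤ 0 := circumradius_le (c := x) le_rfl (empty_subset _)
    linarith
  obtain ⟨y, hy, hmax⟩ := hcomp.exists_isMaxOn hne
    (f := fun y : E => ‖y - x - s • w‖) (by fun_prop)
  have : r ≤ ‖y - x - s • w‖ := by
    refine circumradius_le (c := x + s • w) (norm_nonneg _) fun t ht => ?_
    rw [mem_closedBall, dist_eq_norm, ← sub_sub]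
    exact hmax ht
  exact this.not_gt (hsK y hy hy)

/-- In the plane, a compact part of a sphere lying strictly on one side of the line `ℝ u` and
strictly above the supporting line at `-u` can be moved strictly inwards. -/
theorem exists_shrinking_direction (hE : Module.finrank ℝ E = 2) {T : Set E} {r : ℝ}
    (hT : IsCompact T) (hTr : ∀ t ∈ T, ‖t‖ = r) {g l : E →L[ℝ] ℝ} {u : E} (hg : g ≠ 0)
    (hgT : ∀ t ∈ T, 0 < g t) (hu : ‖u‖ = 1) (hgu : g u = 0) (hl : ‖l‖ = 1) (hlu : l u = 1)
    (hlT : ∀ t ∈ T, -r < l t) : ∃ w : E, ∀ t ∈ T, ∃ s : ℝ, 0 < s ∧ ‖t - s • w‖ < r := by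
  have : FiniteDimensional ℝ E := .of_finrank_pos (by omega)
  have hdecomp : ∃ v : E, ∀ t : E, t = g t • v + l t • u := by
    obtain ⟨p, hp⟩ : ∃ p, g p ≠ 0 := by
      by_contra! h
      exact hg (ContinuousLinearMap.ext h)
    -- The vector dual to `g`: `g v = 1` and `l v = 0`.
    refine ⟨(g p)⁻¹ • (p - l p • u), ?_⟩
    have hu0 : u ≠ 0 := by rintro rfl; simp at hu
    have hli : LinearIndependent ℝ ![u, p] := by
      rw [LinearIndependent.pair_iff]
      intro a b hab
      have hb : b = 0 := by
        have := congrArg g hab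
        simpa [hgu, hp] using this
      subst hb
      simpa [hu0] using hab
    intro t
    have hspan : t ∈ Submodule.span ℝ (range ![u, p]) := by
      rw [hli.span_eq_top_of_card_eq_finrank' (by simp [hE])]
      trivial
    rw [Matrix.range_cons, Matrix.range_cons, Matrix.range_empty, union_empty,
      singleton_union, Submodule.mem_span_pair] at hspan
    obtain ⟨a, b, rfl⟩ := hspan
    simp only [map_add, map_smul, hgu, hlu, smul_eq_mul, mul_zero, zero_add, mul_one, smul_smul,
      mul_inv_cancel_right₀ hp, smul_sub, add_smul]
    rw [show b * g p * ((g p)⁻¹ * l p) = b * l p by field_simp]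
    abel
  obtain ⟨v, hv⟩ := hdecomp
  obtain ⟨ε, hε, hεT⟩ : ∃ ε : ℝ, 0 < ε ∧ ∀ t ∈ T, ε * g t < l t + r := by
    rcases T.eq_empty_or_nonempty with rfl | hne
    · exact ⟨1, one_pos, by simp⟩
    obtain ⟨y, hy, hmin⟩ := hT.exists_isMinOn hne (f := fun t => (l t + r) / g t)
      (ContinuousOn.div (by fun_prop) (by fun_prop) fun t ht => (hgT t ht).ne')
    have hy0 : 0 < (l y + r) / g y := div_pos (by linarith [hlT y hy]) (hgT y hy)
    refine ⟨(l y + r) / g y / 2, half_pos hy0, fun t ht => ?_⟩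
    rw [← lt_div_iff₀ (hgT t ht)]
    exact (half_lt_self hy0).trans_le (hmin ht)
  -- The step `g t` cancels the `v`-component; the tilt `ε` pushes the rest strictly below `r`, even
  -- where `l t = r`.
  refine ⟨v + ε • u, fun t ht => ⟨g t, hgT t ht, ?_⟩⟩
  have e : t - g t • (v + ε • u) = (l t - ε * g t) • u := by
    nth_rewrite 1 [hv t]
    rw [smul_add, smul_smul, sub_smul, mul_comm]
    abel
  rw [e, norm_smul, hu, mul_one, Real.norm_eq_abs, abs_lt]
  have h1 : l t ≤ r := by
    have := (le_abs_self _).trans (l.le_opNorm t)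
    rwa [hl, one_mul, hTr t ht] at this
  have h2 := mul_pos hε (hgT t ht)
  constructor <;> linarith [hεT t ht]

/-- In finite dimension, the convex hull of a compact set is compact. -/
theorem isCompact_convexHull_of_isCompact {E : Type*} [NormedAddCommGroup E] [NormedSpace ℝ E]
    [FiniteDimensional ℝ E] {s : Set E} (hs : IsCompact s) : IsCompact (convexHull ℝ s) := by
  let N := Module.finrank ℝ E + 1
  have h : convexHull ℝ s = (fun p : (Fin N → ℝ) × (Fin N → E) => ∑ i, p.1 i • p.2 i) ''
      (stdSimplex ℝ (Fin N) ×ˢ univ.pi fun _ => s) := by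
    apply Subset.antisymm
    · intro x hx
      obtain ⟨ι, _, z, w, hz, hzi, hw, hw1, hzx⟩ := eq_pos_convex_span_of_mem_convexHull hx
      obtain ⟨z₀, hz₀⟩ := convexHull_nonempty_iff.1 ⟨x, hx⟩
      have hcard : Fintype.card ι ≤ Fintype.card (Fin N) := by
        have := hzi.card_le_finrank_succ
        have := Submodule.finrank_le (vectorSpan ℝ (range z))
        simp only [Fintype.card_fin, N]
        omega
      obtain ⟨f⟩ := Function.Embedding.nonempty_of_card_le hcard
      have hW : ∀ i ∉ range f, Function.extend f w 0 i = 0 := fun i hi =>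
        Function.extend_apply' _ _ _ hi
      -- Carathéodory's combination is padded to `N` terms by copies of `z₀` with weight zero.
      refine ⟨(Function.extend f w 0, Function.extend f z fun _ => z₀), ⟨⟨fun i => ?_, ?_⟩, ?_⟩, ?_⟩
      · by_cases hi : i ∈ range f
        · obtain ⟨j, rfl⟩ := hi
          simpa [f.injective.extend_apply] using (hw j).le
        · exact (hW i hi).ge
      · rw [← hw1]
        exact (Fintype.sum_of_injective f f.injective _ _ hW fun i => by
          rw [f.injective.extend_apply]).symm
      · intro i _
        by_cases hi : i ∈ range f
        · obtain ⟨j, rfl⟩ := hi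
          simpa [f.injective.extend_apply] using hz (mem_range_self j)
        · simpa [Function.extend_apply' _ _ _ hi] using hz₀
      · rw [← hzx]
        refine (Fintype.sum_of_injective f f.injective _ _ (fun i hi => ?_) fun i => ?_).symm
        · simp only [hW i hi, zero_smul]
        · simp only [f.injective.extend_apply]
    · rintro _ ⟨⟨w, z⟩, ⟨hw, hz⟩, rfl⟩
      exact (convex_convexHull ℝ s).sum_mem (fun i _ => hw.1 i) hw.2
        fun i _ => subset_convexHull ℝ s (hz i (mem_univ i))
  rw [h]
  exact ((isCompact_stdSimplex ℝ (Fin N)).prod (isCompact_univ_pi fun _ => hs)).image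
    (by fun_prop)

theorem mem_convexHull_contact (hE : Module.finrank ℝ E = 2) {K : Set E} {x : E}
    (hcomp : IsCompact K) (hK : ¬ IsCentrable K) (hx : IsMinimalEnclosingCenter K x) :
    x ∈ convexHull ℝ (K ∩ sphere x (circumradius K)) := by
  have : FiniteDimensional ℝ E := .of_finrank_pos (by omega)
  have hpos := circumradius_pos_of_not_isCentrable hK hx
  have hdiam := diam_lt_of_not_isCentrable hK hx
  set r := circumradius K with hr
  by_contra hxT
  have hT : IsCompact (K ∩ sphere x r) := hcomp.inter_right isClosed_sphere
  obtain ⟨g, c, hgx, hgc⟩ := geometric_hahn_banach_point_closed (convex_convexHull ℝ _)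
    (isCompact_convexHull_of_isCompact hT).isClosed hxT
  have hgT : ∀ t ∈ K ∩ sphere x r, 0 < g (t - x) := fun t ht => by
    have := hgc t (subset_convexHull ℝ _ ht)
    rw [map_sub]
    linarith
  obtain ⟨t₀, ht₀, ht₀r, -⟩ := exists_contact_not_shrinking hcomp hpos hx 0
  have hg : g ≠ 0 := by
    rintro rfl
    simpa using hgT t₀ ⟨ht₀, by simpa [dist_eq_norm] using ht₀r⟩
  obtain ⟨u₀, hu₀, hgu₀⟩ : ∃ u : E, u ≠ 0 ∧ g u = 0 := by
    have := LinearMap.ker_ne_bot_of_finrank_lt (f := (g : E →ₗ[ℝ] ℝ)) (by simp [hE])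
    obtain ⟨u, hu, hu0⟩ := Submodule.exists_mem_ne_zero_of_ne_bot this
    exact ⟨u, hu0, hu⟩
  obtain ⟨u, hu, hgu⟩ : ∃ u : E, ‖u‖ = 1 ∧ g u = 0 :=
    ⟨‖u₀‖⁻¹ • u₀, by simp [norm_smul, hu₀], by simp [hgu₀]⟩
  obtain ⟨l, hl, hlu⟩ := exists_dual_vector ℝ u (by simp [hu])
  have hlu : l u = 1 := by simpa [hu] using hlu
  have key : ∀ (φ : E →L[ℝ] ℝ) (u : E), ‖u‖ = 1 → g u = 0 → ‖φ‖ = 1 → φ u = 1 →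
      ∃ t ∈ K ∩ sphere x r, φ (t - x) ≤ -r := by
    intro φ u hu hgu hφ hφu
    by_contra! hφT
    obtain ⟨w, hw⟩ := exists_shrinking_direction hE (r := r) (g := g) (l := φ) (u := u)
      (hT.image (f := fun t => t - x) (by fun_prop)) (by
        rintro _ ⟨t, ht, rfl⟩
        simpa [dist_eq_norm] using ht.2) hg (by rintro _ ⟨t, ht, rfl⟩; exact hgT t ht)
      hu hgu hφ hφu (by rintro _ ⟨t, ht, rfl⟩; exact hφT t ht)
    obtain ⟨t, htK, htr, ht⟩ := exists_contact_not_shrinking hcomp hpos hx w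
    obtain ⟨s, hs, h⟩ := hw _ ⟨t, ⟨htK, by simpa [dist_eq_norm] using htr⟩, rfl⟩
    exact (ht s hs).not_gt h
  obtain ⟨p, hp, hp'⟩ := key l u hu hgu hl hlu
  -- `l` now separates `p` and `q` by at least `2r`.
  obtain ⟨q, hq, hq'⟩ := key (-l) (-u) (by simpa) (by simpa) (by simpa) (by simpa)
  have h1 : dist q p ≤ diam K := dist_le_diam_of_mem hcomp.isBounded hq.1 hp.1
  have h2 := (le_abs_self _).trans (l.le_opNorm (q - p))
  rw [hl, one_mul, ← dist_eq_norm] at h2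
  simp only [neg_apply, map_sub] at hp' hq' h2
  linarith

end Chebyshev

open Chebyshev

theorem mainTheorem3 {E : Type*} [NormedAddCommGroup E] [NormedSpace ℝ E]
    (hE : Module.finrank ℝ E = 2) (K : Set E) (hcomp : IsCompact K) (hconv : Convex ℝ K)
    (hK : ¬ Chebyshev.IsCentrable K) (x : E) (hx : Chebyshev.IsMinimalEnclosingCenter K x) :
    ∃ m : ℕ, (m = 2 ∨ m = 3) ∧ ∃ t : Fin m → E,
      (∀ i, t i ∈ Chebyshev.criticalSet K x) ∧ AffineIndependent ℝ t ∧
      x ∈ intrinsicInterior ℝ (convexHull ℝ (Set.range t)) := by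
  have : FiniteDimensional ℝ E := .of_finrank_pos (by omega)
  have hpos := circumradius_pos_of_not_isCentrable hK hx
  have hdiam := diam_lt_of_not_isCentrable hK hx
  obtain ⟨ι, _, z, w, hz, hzi, hw, hw1, hzx⟩ :=
    eq_pos_convex_span_of_mem_convexHull (mem_convexHull_contact hE hcomp hK hx)
  have hcard : Fintype.card ι ≤ 3 := by
    have := hzi.card_le_finrank_succ
    have := Submodule.finrank_le (vectorSpan ℝ (range z))
    omega
  obtain ⟨n, hn⟩ : ∃ n, n = Fintype.card ι := ⟨_, rfl⟩
  obtain ⟨e⟩ : Nonempty (Fin n ≃ ι) := by rw [hn]; exact ⟨(Fintype.equivFin ι).symm⟩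
  rw [← hn] at hcard
  rw [← e.sum_comp] at hw1 hzx
  have hmem : ∀ i, z i ∈ K ∧ ‖z i - x‖ = circumradius K := fun i => by
    simpa [dist_eq_norm] using hz (mem_range_self i)
  have hbal : ∑ i, w (e i) • (z (e i) - x) = 0 := by
    simp only [smul_sub, Finset.sum_sub_distrib, ← Finset.sum_smul, hw1, hzx, one_smul, sub_self]
  have hn3 : n = 3 := by
    interval_cases n
    · simp at hw1
    · have h0 := (hmem (e 0)).2
      simp only [Fin.sum_univ_one] at hw1 hbal
      rw [hw1, one_smul] at hbal
      rw [hbal, norm_zero] at h0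
      exact absurd h0 hpos.ne
    · simp only [Fin.sum_univ_two] at hw1 hbal
      have h0 := hmem (e 0)
      have h1 := hmem (e 1)
      have hneg := eq_neg_of_add_eq_zero_left hbal
      have hw01 : w (e 0) = w (e 1) := by
        have := congrArg norm hneg
        rw [norm_neg, norm_smul, norm_smul, h0.2, h1.2, Real.norm_of_nonneg (hw _).le,
          Real.norm_of_nonneg (hw _).le] at this
        exact mul_right_cancel₀ hpos.ne' this
      rw [hw01, ← smul_neg] at hneg
      have hanti := smul_right_injective E (hw (e 1)).ne' hneg
      have hd := dist_le_diam_of_mem hcomp.isBounded h0.1 h1.1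
      have : z (e 0) - z (e 1) = (2 : ℝ) • (z (e 0) - x) := by
        have : z (e 1) = x - (z (e 0) - x) := by
          rw [show z (e 0) - x = -(z (e 1) - x) from hanti]; abel
        rw [this, two_smul]; abel
      rw [dist_eq_norm, this, norm_smul, h0.2, Real.norm_two] at hd
      linarith
    · rfl
  subst hn3
  refine ⟨3, .inr rfl, z ∘ e, fun i => ?_, hzi.comp_embedding e.toEmbedding, ?_⟩
  · have hs : z (e i) ∈ frontier (closedBall x (circumradius K)) := by
      rw [frontier_closedBall _ hpos.ne']
      simpa [dist_eq_norm] using (hmem (e i)).2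
    -- An interior point of `K` would be interior to the ball.
    exact ⟨⟨subset_closure (hmem _).1, fun h => hs.2 (interior_mono hx h)⟩, hs⟩
  · have hind : AffineIndependent ℝ (z ∘ e) := hzi.comp_embedding e.toEmbedding
    let b : AffineBasis (Fin 3) ℝ E :=
      ⟨z ∘ e, hind, hind.affineSpan_eq_top_iff_card_eq_finrank_add_one.2 (by simp [hE])⟩
    apply interior_subset_intrinsicInterior
    change x ∈ interior (convexHull ℝ (range b))
    rw [b.interior_convexHull]
    intro i
    have hxb : x = Finset.univ.affineCombination ℝ b (fun i => w (e i)) := by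
      rw [Finset.affineCombination_eq_linear_combination _ _ _ hw1]
      exact hzx.symm
    rw [hxb, b.coord_apply_combination_of_mem (Finset.mem_univ i) hw1]
    exact hw _
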